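/- For $(t_1,t_2)$ and $(z,w)$ put $$F_{t_1,t_2}(z,w)=\bigl((t_1w^2-t_2z^2)^2,\;4t_2\,zw(w-z)(t_1w-t_2z)\bigr),$$ and $\|(z,w)\|=\max\{|z|,|w|\}$ on $\mathbb{C}^2$. Let $c\in\mathbb{C}(t)$ with $c\neq 0,1,t$, and let $C=(c_1,c_2)$ be a homogeneous lift of $c$: a pair of homogeneous polynomials in $\mathbb{C}[t_1,t_2]$ of the same degree, without common factor, such that $c(t)=c_1(t,1)/c_2(t,1)$. Set $$F_1=(P_1,Q_1)=F_{t_1,t_2}(C)/\gcd(F_{t_1,t_2}(C)),\qquad d=\deg F_1,\qquad F_{n+1}=F_{t_1,t_2}(F_n)/t_2^2\quad(n\ge 1),$$ where $\gcd(P,Q)$ is any greatest common divisor of $P$ and $Q$ in $\mathbb{C}[t_1,t_2]$ and $\deg$ of a pair is the common degree of its two homogeneous entries. Then $d\geq 1$; for every $n\ge1$ the division by $t_2^2$ is exact, $F_n$ is a pair of homogeneous polynomials of degree $\deg F_n=4^{n-1}d$, and $F_n$ has no zero in $\mathbb{C}^2\setminus\{(0,0)\}$. The sequence $$\frac{1}{\deg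 F_n}\log\|F_n(t_1,t_2)\|$$ converges, as $n\to\infty$, locally uniformly on $\mathbb{C}^2\setminus\{(0,0)\}$ to a continuous plurisubharmonic function $G_C$. At the degenerate parameters $t=t_1/t_2=\infty,0,1$ the numbers $P_1(1,0)$, $P_1(0,1)$ and $P_1(1,1)-Q_1(1,1)$ are nonzero and $$G_C(1,0)=\tfrac1d\log|P_1(1,0)|,\qquad G_C(0,1)=\tfrac1d\log|P_1(0,1)|,\qquad G_C(1,1)=\tfrac1d\log|P_1(1,1)-Q_1(1,1)|.$$ -/

import Mathlib

/-- A pair `(P, Q)` of complex polynomials in the two variables `t₁ = X 0` and `t₂ = X 1`. -/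
abbrev PolyPair : Type := MvPolynomial (Fin 2) ℂ × MvPolynomial (Fin 2) ℂ

namespace PolyPair

/-- The degree of a pair. For a nonzero pair of homogeneous polynomials of the same degree this is
their common degree. -/
noncomputable def deg (F : PolyPair) : ℕ := max F.1.totalDegree F.2.totalDegree

/-- Both entries are homogeneous of degree `m`. -/
def IsHomogeneous (F : PolyPair) (m : ℕ) : Prop :=
  F.1.IsHomogeneous m ∧ F.2.IsHomogeneous m

/-- The value of a pair at `(t₁, t₂) ∈ ℂ²`. The norm of `ℂ × ℂ` is `max |z| |w|`. -/
noncomputable def eval (F : PolyPair) (t : Fin 2 → ℂ) : ℂ × ℂ :=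
  (MvPolynomial.eval t F.1, MvPolynomial.eval t F.2)

/-- `g` is a greatest common divisor of the two entries of `F` (unique up to a nonzero constant). -/
def IsGCD (F : PolyPair) (g : MvPolynomial (Fin 2) ℂ) : Prop :=
  g ∣ F.1 ∧ g ∣ F.2 ∧ ∀ h : MvPolynomial (Fin 2) ℂ, h ∣ F.1 → h ∣ F.2 → h ∣ g

/-- `F = G / gcd(G)`, for some choice of the greatest common divisor. -/
def IsReductionOf (F G : PolyPair) : Prop :=
  ∃ g : MvPolynomial (Fin 2) ℂ, g ≠ 0 ∧ G.IsGCD g ∧ g * F.1 = G.1 ∧ g * F.2 = G.2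

/-- `C = (c₁, c₂)` is a homogeneous lift of `c ∈ ℂ(t)`: homogeneous polynomials of the same degree
with no common factor such that `c(t) = c₁(t, 1) / c₂(t, 1)`. -/
def IsHomogeneousLift (C : PolyPair) (c : RatFunc ℂ) : Prop :=
  (∃ m : ℕ, C.IsHomogeneous m) ∧ IsRelPrime C.1 C.2 ∧
    MvPolynomial.aeval ![(RatFunc.X : RatFunc ℂ), 1] C.2 ≠ 0 ∧
    c = MvPolynomial.aeval ![(RatFunc.X : RatFunc ℂ), 1] C.1 /
      MvPolynomial.aeval ![(RatFunc.X : RatFunc ℂ), 1] C.2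

end PolyPair

/-- The homogenized Lattès family
`F_{t₁,t₂}(z, w) = ((t₁ w² - t₂ z²)², 4 t₂ z w (w - z) (t₁ w - t₂ z))`. -/
def lattesMap {R : Type*} [CommRing R] (t₁ t₂ : R) (p : R × R) : R × R :=
  ((t₁ * p.2 ^ 2 - t₂ * p.1 ^ 2) ^ 2,
    4 * t₂ * p.1 * p.2 * (p.2 - p.1) * (t₁ * p.2 - t₂ * p.1))

namespace PolyPair

/-- `F_{t₁,t₂}(F)`, where `t₁, t₂` are the polynomial variables. -/
noncomputable def lattes (F : PolyPair) : PolyPair :=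
  lattesMap (MvPolynomial.X 0) (MvPolynomial.X 1) F

/-- The quotient of a pair by `t₂²`. (`divMonomial` is polynomial division by a monomial, discarding
a remainder if there is one.) -/
noncomputable def divT₂Sq (F : PolyPair) : PolyPair :=
  (F.1.divMonomial (Finsupp.single 1 2), F.2.divMonomial (Finsupp.single 1 2))

/-- The iterates `F_{n+1} = F_{t₁,t₂}(F_n) / t₂²` starting from `F_1`. The index is shifted by one:
`iter F₁ 0 = F_1`, and `iter F₁ n` is `F_{n+1}`. -/
noncomputable def iter (F₁ : PolyPair) : ℕ → PolyPair
  | 0 => F₁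
  | n + 1 => (iter F₁ n).lattes.divT₂Sq

end PolyPair

/-- A real-valued function `u` is plurisubharmonic on the (open) set `Ω`: it is upper
semicontinuous, and on every closed disc `{a + ζ b : |ζ| ≤ 1} ⊆ Ω` in a complex line the value at
the centre is at most the mean over the boundary circle. (For a real-valued upper semicontinuous
function the sub-mean value inequality, with the mean in `[-∞, ∞)`, forces the integrability that
is recorded here.) -/
def IsPlurisubharmonicOn {E : Type*} [NormedAddCommGroup E] [NormedSpace ℂ E]
    (u : E → ℝ) (Ω : Set E) : Prop :=
  UpperSemicontinuousOn u Ω ∧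
    ∀ a b : E, (∀ ζ : ℂ, ‖ζ‖ ≤ 1 → a + ζ • b ∈ Ω) →
      CircleIntegrable (fun ζ : ℂ => u (a + ζ • b)) 0 1 ∧
        u a ≤ Real.circleAverage (fun ζ : ℂ => u (a + ζ • b)) 0 1

/-! With `s = t₁/t₂`, dividing by `t₂²` turns the recursion into iteration of `F_{s,1}`, a quartic
homogeneous map. Where `s ≠ 0, 1, ∞` this map has no zero off the origin, so compactness bounds
`log‖F_{n+1}‖ - 4 log‖F_n‖` locally uniformly, and `4⁻ⁿ log‖F_n‖` converges geometrically.

At the three degenerate parameters no such bound exists. The first input is algebraic: removing the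
gcd yields a pair `(P, t₂ R)` that avoids the exceptional direction at each of these parameters
(`IsReductionOf.exists_isAdmissible`). The shape `(P, t₂ R)` is preserved by the recursion, which
makes each division by `t₂²` exact.

The second input is analytic. Near `s = 0` the norm is replaced by `N = max(|z|, |s w|)`. Always `N⁴
≤ 8 N(F_{s,1}(z, w))`, while an upper bound costs the square of a bound `A` for `|w|/N`. Along an
orbit `A` obeys `A ↦ 128 A²`, so `log A` grows only like `2ⁿ`, negligible against `4ⁿ`
(`lattesMap_orbit_estimate`). At `s = 0` itself the first coordinate is just raised to the fourth
power, which gives the explicit value of the limit. The points `1` and `∞` reduce to `0` by the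
changes `(z - w, -w)`, `s ↦ 1 - s`, and `(P, t₁ R)`, `s ↦ 1/s`.

Each `log‖F_n‖` is plurisubharmonic by Jensen's formula applied to a coordinate, and the locally
uniform limit inherits continuity and plurisubharmonicity. -/

/-! ### Homogeneous polynomials and binary forms. -/

theorem MvPolynomial.IsHomogeneous.aeval_mul_left {σ R A : Type*} [CommSemiring R]
    [CommSemiring A] [Algebra R A] {p : MvPolynomial σ R} {n : ℕ} (hp : p.IsHomogeneous n) (c : A)
    (f : σ → A) :
    MvPolynomial.aeval (fun i => c * f i) p = c ^ n * MvPolynomial.aeval f p := by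
  rw [MvPolynomial.aeval_def, MvPolynomial.aeval_def, MvPolynomial.eval₂_eq,
    MvPolynomial.eval₂_eq, Finset.mul_sum]
  refine Finset.sum_congr rfl fun d hd => ?_
  simp only [mul_pow, Finset.prod_mul_distrib, Finset.prod_pow_eq_pow_sum]
  rw [← hp.degree_eq_sum_deg_support hd]
  ring

theorem MvPolynomial.aeval_C_X_mul_X_coeff {σ R : Type*} [CommSemiring R]
    (p : MvPolynomial σ R) (k : ℕ) :
    (MvPolynomial.aeval (fun i => (Polynomial.X : Polynomial (MvPolynomial σ R)) *
      Polynomial.C (MvPolynomial.X i)) p).coeff k = MvPolynomial.homogeneousComponent k p := by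
  have hC : ∀ q : MvPolynomial σ R, MvPolynomial.aeval
      (fun i => (Polynomial.C (MvPolynomial.X i) : Polynomial (MvPolynomial σ R))) q
      = Polynomial.C q := by
    intro q
    induction q using MvPolynomial.induction_on with
    | C a => rw [MvPolynomial.aeval_C]; rfl
    | add p q hp hq => simp [hp, hq]
    | mul_X p i hp => simp [hp]
  conv_lhs => rw [← MvPolynomial.sum_homogeneousComponent p]
  rw [map_sum, Polynomial.finsetSum_coeff]
  simp only [(MvPolynomial.homogeneousComponent_isHomogeneous _ p).aeval_mul_left, hC,
    Polynomial.coeff_X_pow_mul', Polynomial.coeff_C]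
  by_cases hk : k ∈ Finset.range (p.totalDegree + 1)
  · rw [Finset.sum_eq_single_of_mem k hk]
    · simp
    · intro b _ hb
      split_ifs with h1 h2
      · omega
      · rfl
      · rfl
  · rw [Finset.sum_eq_zero, MvPolynomial.homogeneousComponent_eq_zero]
    · simpa using hk
    · intro b hb
      simp only [Finset.mem_range] at hb hk
      rw [if_pos (by omega), if_neg (by omega)]

/-- The substitution `X i ↦ T X i` records homogeneous components as coefficients of powers of `T`.
Over a domain both the degree and the lowest degree in `T` add under multiplication. They agree for
the product, hence for each factor. -/
theorem MvPolynomial.IsHomogeneous.exists_of_mul {σ R : Type*} [CommRing R] [IsDomain R]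
    {p q : MvPolynomial σ R} {n : ℕ} (h : (p * q).IsHomogeneous n) (hp : p ≠ 0) (hq : q ≠ 0) :
    ∃ k l, p.IsHomogeneous k ∧ q.IsHomogeneous l ∧ k + l = n := by
  set φ : MvPolynomial σ R →ₐ[R] Polynomial (MvPolynomial σ R) :=
    MvPolynomial.aeval (fun i => Polynomial.X * Polynomial.C (MvPolynomial.X i)) with hφ
  have hcoeff : ∀ p k, (φ p).coeff k = MvPolynomial.homogeneousComponent k p :=
    MvPolynomial.aeval_C_X_mul_X_coeff
  have hone : ∀ p, (φ p).eval 1 = p := by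
    intro p
    induction p using MvPolynomial.induction_on with
    | C a =>
      rw [hφ, MvPolynomial.aeval_C]
      simp
    | add p q hp hq => simp [hp, hq]
    | mul_X p i hp =>
      rw [map_mul, Polynomial.eval_mul, hp, hφ, MvPolynomial.aeval_X]
      simp
  have hne : ∀ p, p ≠ 0 → φ p ≠ 0 := fun p hp h0 => hp (by rw [← hone p, h0]; simp)
  have hmono : ∀ p k, (φ p).natDegree = k → (φ p).natTrailingDegree = k → p.IsHomogeneous k := by
    intro p k h1 h2
    have : MvPolynomial.homogeneousComponent k p = p := by
      conv_rhs => rw [← hone p, Polynomial.eval_eq_sum_range]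
      simp only [one_pow, mul_one]
      rw [Finset.sum_eq_single_of_mem k (by simp [h1]), hcoeff]
      intro b hb hbk
      apply Polynomial.coeff_eq_zero_of_lt_natTrailingDegree
      simp only [Finset.mem_range] at hb
      omega
    rw [← this]
    exact MvPolynomial.homogeneousComponent_isHomogeneous _ _
  have hpq : p * q ≠ 0 := mul_ne_zero hp hq
  have hsupp : ∀ k, (φ (p * q)).coeff k ≠ 0 → k = n := by
    intro k hk
    by_contra hkn
    rw [hcoeff, MvPolynomial.homogeneousComponent_of_mem h, if_neg hkn] at hk
    exact hk rfl
  have hd : (φ (p * q)).natDegree = n :=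
    hsupp _ (by simpa using hne _ hpq)
  have ht : (φ (p * q)).natTrailingDegree = n :=
    hsupp _ (Polynomial.trailingCoeff_nonzero_iff_nonzero.mpr (hne _ hpq))
  rw [map_mul, Polynomial.natDegree_mul (hne _ hp) (hne _ hq)] at hd
  rw [map_mul, Polynomial.natTrailingDegree_mul (hne _ hp) (hne _ hq)] at ht
  have h1 := (φ p).natTrailingDegree_le_natDegree
  have h2 := (φ q).natTrailingDegree_le_natDegree
  exact ⟨_, _, hmono p _ rfl (by omega), hmono q _ rfl (by omega), hd⟩

/-- A binary form vanishing at a point `(a, b)` off the origin is divisible by `b X - a Y`. -/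
theorem MvPolynomial.IsHomogeneous.linear_dvd {K : Type*} [Field K]
    {p : MvPolynomial (Fin 2) K} {n : ℕ} (hp : p.IsHomogeneous n) {t : Fin 2 → K} (ht : t ≠ 0)
    (h : MvPolynomial.eval t p = 0) :
    MvPolynomial.C (t 1) * MvPolynomial.X 0 - MvPolynomial.C (t 0) * MvPolynomial.X 1 ∣ p := by
  set L : MvPolynomial (Fin 2) K :=
    MvPolynomial.C (t 1) * MvPolynomial.X 0 - MvPolynomial.C (t 0) * MvPolynomial.X 1 with hL
  obtain ⟨j, hj⟩ : ∃ j, t j ≠ 0 := Function.ne_iff.mp ht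
  let π := Ideal.Quotient.mkₐ K (Ideal.span {L})
  have hπ : ∀ q, π q = 0 ↔ L ∣ q := fun q => by
    simp [π, Ideal.Quotient.eq_zero_iff_mem, Ideal.mem_span_singleton]
  have hsymm : ∀ i, π (MvPolynomial.C (t j)) * π (MvPolynomial.X i) =
      π (MvPolynomial.X j) * π (MvPolynomial.C (t i)) := by
    intro i
    rw [← map_mul, ← map_mul, ← sub_eq_zero, ← map_sub, hπ]
    fin_cases i <;> fin_cases j <;> simp only [Fin.zero_eta, Fin.mk_one, Fin.isValue]
    · exact ⟨0, by ring⟩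
    · exact ⟨1, by rw [hL]; ring⟩
    · exact ⟨-1, by rw [hL]; ring⟩
    · exact ⟨0, by ring⟩
  have hX : ∀ q, MvPolynomial.aeval (fun i => π (MvPolynomial.X i)) q = π q := fun q => by
    rw [← MvPolynomial.comp_aeval_apply, MvPolynomial.aeval_X_left_apply]
  have hc : MvPolynomial.aeval (fun i => π (MvPolynomial.C (t i))) p = 0 := by
    rw [← MvPolynomial.comp_aeval_apply]
    have hC : ∀ q, MvPolynomial.aeval (fun i => (MvPolynomial.C (t i) : MvPolynomial (Fin 2) K)) q
        = MvPolynomial.C (MvPolynomial.eval t q) := by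
      intro q
      induction q using MvPolynomial.induction_on with
      | C a => rw [MvPolynomial.aeval_C, MvPolynomial.eval_C]; rfl
      | add p q hp hq => rw [map_add, hp, hq, map_add, map_add]
      | mul_X p i hp => rw [map_mul, hp, MvPolynomial.aeval_X, map_mul, MvPolynomial.eval_X, map_mul]
    rw [hC, h]
    simp
  -- Modulo the linear form, `t j • X` equals `X j • t`, so homogeneity gives `(t j)ⁿ p(X) = (X j)ⁿ
  -- p(t) = 0` in the quotient.
  have key := hp.aeval_mul_left (π (MvPolynomial.C (t j))) (fun i => π (MvPolynomial.X i))
  simp only [hsymm] at key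
  rw [hp.aeval_mul_left, hc, mul_zero, hX, ← map_pow, ← map_mul, eq_comm, hπ] at key
  have hu : IsUnit ((MvPolynomial.C (t j) : MvPolynomial (Fin 2) K) ^ n) :=
    ((isUnit_iff_ne_zero.mpr hj).map MvPolynomial.C).pow n
  exact (hu.dvd_mul_left).mp key

/-- Relatively prime binary forms have no common zero off the origin. -/
theorem MvPolynomial.IsHomogeneous.eval_ne_zero_of_isRelPrime {K : Type*} [Field K]
    {p q : MvPolynomial (Fin 2) K} {n m : ℕ} (hp : p.IsHomogeneous n) (hq : q.IsHomogeneous m)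
    (hpq : IsRelPrime p q) {t : Fin 2 → K} (ht : t ≠ 0) :
    MvPolynomial.eval t p ≠ 0 ∨ MvPolynomial.eval t q ≠ 0 := by
  by_contra! h
  have hu := hpq (hp.linear_dvd ht h.1) (hq.linear_dvd ht h.2)
  have := hu.map (MvPolynomial.eval t)
  simp [mul_comm] at this

theorem MvPolynomial.prime_X_one_sub_X_zero {K : Type*} [Field K] :
    Prime (MvPolynomial.X 1 - MvPolynomial.X 0 : MvPolynomial (Fin 2) K) := by
  let e : MvPolynomial (Fin 2) K ≃ₐ[K] MvPolynomial (Fin 2) K :=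
    AlgEquiv.ofAlgHom (MvPolynomial.aeval ![MvPolynomial.X 0, MvPolynomial.X 1 - MvPolynomial.X 0])
      (MvPolynomial.aeval ![MvPolynomial.X 0, MvPolynomial.X 1 + MvPolynomial.X 0])
      (by ext i; fin_cases i <;> simp) (by ext i; fin_cases i <;> simp)
  have he : e (MvPolynomial.X 1) = MvPolynomial.X 1 - MvPolynomial.X 0 := by simp [e]
  rw [← he]
  exact (MulEquiv.prime_iff e.toMulEquiv).mpr MvPolynomial.X_prime

/-! ### Removing the gcd at a degenerate parameter. -/

section LattesGCD

variable {R : Type*} [CommRing R] [IsDomain R] {h u z w g P Q : R}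

/-- If `h ∤ z`, the first entry is already prime to `h`. If `h ∣ z`, both entries are divisible by
`h²`, so `g` absorbs this factor, and what remains of the first entry is `w⁴` modulo `h`. Here `h`
is `t₁`, or `t₂ - t₁` after conjugation. -/
theorem Prime.not_dvd_of_lattesMap_fst (hh : Prime h) (hu : ¬ h ∣ u) (hzw : h ∣ z → ¬ h ∣ w)
    (hg : ∀ k, k ∣ (lattesMap h u (z, w)).1 → k ∣ (lattesMap h u (z, w)).2 → k ∣ g)
    (hP : g * P = (lattesMap h u (z, w)).1) : ¬ h ∣ P := by
  simp only [lattesMap] at hg hP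
  intro hdvd
  by_cases hz : h ∣ z
  · obtain ⟨e, rfl⟩ := hz
    obtain ⟨g', rfl⟩ : h ^ 2 ∣ g := hg _ ⟨(w ^ 2 - h * u * e ^ 2) ^ 2, by ring⟩
      ⟨4 * u * e * w * (w - h * e) * (w - u * e), by ring⟩
    have h1 : g' * P = (w ^ 2 - h * u * e ^ 2) ^ 2 :=
      mul_left_cancel₀ (pow_ne_zero 2 hh.ne_zero) (by linear_combination hP)
    have h2 := hh.dvd_of_dvd_pow (h1 ▸ hdvd.mul_left g')
    rw [mul_assoc, dvd_sub_left (dvd_mul_right h _)] at h2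
    exact hzw (dvd_mul_right h e) (hh.dvd_of_dvd_pow h2)
  · have h2 := hh.dvd_of_dvd_pow (hP ▸ hdvd.mul_left g)
    rw [dvd_sub_right (dvd_mul_right h _)] at h2
    rcases hh.dvd_or_dvd h2 with h3 | h3
    exacts [hu h3, hz (hh.dvd_of_dvd_pow h3)]

/-- Here `h` plays the role of `t₂`. When `h ∣ w`, the first entry contains `h` exactly twice and
the second at least three times, so a factor `h` survives in `Q` after cancellation. It is this
factor that makes the later divisions by `t₂²` exact. -/
theorem Prime.not_dvd_and_dvd_of_lattesMap_snd (hh : Prime h) (hu : ¬ h ∣ u)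
    (hzw : h ∣ z → ¬ h ∣ w)
    (hg : ∀ k, k ∣ (lattesMap u h (z, w)).1 → k ∣ (lattesMap u h (z, w)).2 → k ∣ g)
    (hP : g * P = (lattesMap u h (z, w)).1) (hQ : g * Q = (lattesMap u h (z, w)).2) :
    ¬ h ∣ P ∧ h ∣ Q := by
  simp only [lattesMap] at hg hP hQ
  by_cases hw : h ∣ w
  · obtain ⟨e, rfl⟩ := hw
    obtain ⟨g', rfl⟩ : h ^ 2 ∣ g := hg _ ⟨(h * u * e ^ 2 - z ^ 2) ^ 2, by ring⟩
      ⟨4 * h * z * e * (h * e - z) * (u * e - z), by ring⟩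
    have h1 : g' * P = (h * u * e ^ 2 - z ^ 2) ^ 2 :=
      mul_left_cancel₀ (pow_ne_zero 2 hh.ne_zero) (by linear_combination hP)
    have h2 : g' * Q = h * (4 * z * e * (h * e - z) * (u * e - z)) :=
      mul_left_cancel₀ (pow_ne_zero 2 hh.ne_zero) (by linear_combination hQ)
    have h3 : ¬ h ∣ g' * P := fun hd => by
      rw [h1] at hd
      have := hh.dvd_of_dvd_pow hd
      rw [mul_assoc, dvd_sub_right (dvd_mul_right h _)] at this
      exact hzw (hh.dvd_of_dvd_pow this) (dvd_mul_right h e)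
    exact ⟨fun hd => h3 (hd.mul_left _),
      (hh.dvd_or_dvd ⟨_, h2⟩).resolve_left fun hd => h3 (hd.mul_right _)⟩
  · have h3 : ¬ h ∣ g * P := fun hd => by
      rw [hP] at hd
      have := hh.dvd_of_dvd_pow hd
      rw [dvd_sub_left (dvd_mul_right h _)] at this
      rcases hh.dvd_or_dvd this with h4 | h4
      exacts [hu h4, hw (hh.dvd_of_dvd_pow h4)]
    exact ⟨fun hd => h3 (hd.mul_left _), (hh.dvd_or_dvd (hQ ▸
      ⟨4 * z * w * (w - z) * (u * w - h * z), by ring⟩ : h ∣ g * Q)).resolve_left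
        fun hd => h3 (hd.mul_right _)⟩

end LattesGCD

/-- The coordinate change `(z, w) ↦ (z - w, -w)` conjugates the Lattès map with parameters
`(t₁, t₂)` to the one with parameters `(t₂ - t₁, t₂)`. -/
theorem lattesMap_sub {R : Type*} [CommRing R] (t₁ t₂ z w : R) :
    lattesMap (t₂ - t₁) t₂ (z - w, -w) = ((lattesMap t₁ t₂ (z, w)).1 - (lattesMap t₁ t₂ (z, w)).2,
      -(lattesMap t₁ t₂ (z, w)).2) := by
  ext <;> simp only [lattesMap] <;> ring

/-! ### Admissible pairs and exactness of the iteration. -/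

namespace PolyPair

theorem IsHomogeneous.deg_eq {F : PolyPair} {m : ℕ} (hF : F.IsHomogeneous m) (h : F.1 ≠ 0) :
    F.deg = m := by
  rw [deg, hF.1.totalDegree h, max_eq_left hF.2.totalDegree_le]

theorem IsHomogeneous.lattes {F : PolyPair} {m : ℕ} (hF : F.IsHomogeneous m) :
    F.lattes.IsHomogeneous (4 * m + 2) := by
  have h0 := MvPolynomial.isHomogeneous_X ℂ (0 : Fin 2)
  have h1 := MvPolynomial.isHomogeneous_X ℂ (1 : Fin 2)
  have h4 : (4 : MvPolynomial (Fin 2) ℂ).IsHomogeneous 0 := MvPolynomial.isHomogeneous_C _ (4 : ℂ)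
  refine ⟨?_, ?_⟩
  · have ha := h0.mul (hF.2.pow 2)
    have hb := h1.mul (hF.1.pow 2)
    have h := (ha.sub hb).pow 2
    rw [show (1 + m * 2) * 2 = 4 * m + 2 by ring] at h
    exact h
  · convert (((h4.mul h1).mul hF.1).mul hF.2).mul (hF.2.sub hF.1) |>.mul
      ((h0.mul hF.2).sub (h1.mul hF.1)) using 1
    · rfl
    · ring

theorem IsHomogeneousLift.lattes_snd_ne_zero {c : RatFunc ℂ} {C : PolyPair}
    (hC : C.IsHomogeneousLift c) (hc0 : c ≠ 0) (hc1 : c ≠ 1) (hct : c ≠ RatFunc.X) :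
    C.lattes.2 ≠ 0 := by
  obtain ⟨-, -, h2, hc⟩ := hC
  have hX1 : (MvPolynomial.X 1 : MvPolynomial (Fin 2) ℂ) ≠ 0 := MvPolynomial.X_ne_zero 1
  have h1 : C.1 ≠ 0 := fun h => hc0 (by rw [hc, h]; simp)
  have h2' : C.2 ≠ 0 := fun h => h2 (by rw [h]; simp)
  have h3 : C.2 - C.1 ≠ 0 := fun h => hc1 (by rw [hc, ← sub_eq_zero.mp h, div_self h2])
  have h4 : MvPolynomial.X 0 * C.2 - MvPolynomial.X 1 * C.1 ≠ 0 := fun h => hct (by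
    have := congrArg (MvPolynomial.aeval ![(RatFunc.X : RatFunc ℂ), 1]) (sub_eq_zero.mp h)
    simp only [map_mul, MvPolynomial.aeval_X, Matrix.cons_val_zero, Matrix.cons_val_one,
      one_mul] at this
    rw [hc, ← this, mul_div_cancel_right₀ _ h2])
  have h5 : (4 : MvPolynomial (Fin 2) ℂ) ≠ 0 :=
    (map_ne_zero_iff MvPolynomial.C (MvPolynomial.C_injective _ ℂ)).mpr (by norm_num : (4 : ℂ) ≠ 0)
  simp only [PolyPair.lattes, lattesMap]
  exact mul_ne_zero (mul_ne_zero (mul_ne_zero (mul_ne_zero (mul_ne_zero h5 hX1) h1) h2')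
    h3) h4

/-- The pair `F` has the form `(P, t₂ R)` with `P`, `t₂ R` relatively prime and homogeneous of
degree `e + 1`, and it avoids the exceptional directions at the three degenerate parameters. -/
structure IsAdmissible (F : PolyPair) (R : MvPolynomial (Fin 2) ℂ) (e : ℕ) : Prop where
  snd_eq : F.2 = MvPolynomial.X 1 * R
  fst_homogeneous : F.1.IsHomogeneous (e + 1)
  homogeneous : R.IsHomogeneous e
  isRelPrime : IsRelPrime F.1 F.2
  eval_infty : (F.eval ![1, 0]).1 ≠ 0
  eval_zero : (F.eval ![0, 1]).1 ≠ 0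
  eval_one : (F.eval ![1, 1]).1 ≠ (F.eval ![1, 1]).2

theorem IsReductionOf.isRelPrime {F G : PolyPair} (h : F.IsReductionOf G) :
    IsRelPrime F.1 F.2 := by
  obtain ⟨g, hg0, ⟨-, -, hg⟩, h1, h2⟩ := h
  intro k hk1 hk2
  have : g * k ∣ g := hg _ (h1 ▸ mul_dvd_mul_left g hk1) (h2 ▸ mul_dvd_mul_left g hk2)
  have : g * k ∣ g * 1 := by simpa using this
  exact isUnit_of_dvd_one ((mul_dvd_mul_iff_left hg0).mp this)

theorem IsReductionOf.exists_isAdmissible {c : RatFunc ℂ} (hc0 : c ≠ 0) (hc1 : c ≠ 1)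
    (hct : c ≠ RatFunc.X) {C : PolyPair} (hC : C.IsHomogeneousLift c) {F : PolyPair}
    (hF : F.IsReductionOf C.lattes) : ∃ R e, F.IsAdmissible R e := by
  have hrel := hF.isRelPrime
  have hsnd := hC.lattes_snd_ne_zero hc0 hc1 hct
  obtain ⟨g, hg0, ⟨hgd1, hgd2, hg⟩, h1, h2⟩ := hF
  obtain ⟨⟨m, hm⟩, hrelC, -, -⟩ := hC
  have hne : ∀ {h : MvPolynomial (Fin 2) ℂ}, Prime h → h ∣ C.1 → ¬ h ∣ C.2 :=
    fun hh hd1 hd2 => hh.not_isUnit (hrelC hd1 hd2)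
  have hp0 : Prime (MvPolynomial.X 0 : MvPolynomial (Fin 2) ℂ) := MvPolynomial.X_prime
  have hp1 : Prime (MvPolynomial.X 1 : MvPolynomial (Fin 2) ℂ) := MvPolynomial.X_prime
  have hps := MvPolynomial.prime_X_one_sub_X_zero (K := ℂ)
  have h01 : ¬ (MvPolynomial.X 0 : MvPolynomial (Fin 2) ℂ) ∣ MvPolynomial.X 1 := by
    rintro ⟨k, hk⟩
    simpa using congrArg (MvPolynomial.eval ![0, 1]) hk
  have h10 : ¬ (MvPolynomial.X 1 : MvPolynomial (Fin 2) ℂ) ∣ MvPolynomial.X 0 := by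
    rintro ⟨k, hk⟩
    simpa using congrArg (MvPolynomial.eval ![1, 0]) hk
  have hs1 : ¬ (MvPolynomial.X 1 - MvPolynomial.X 0 : MvPolynomial (Fin 2) ℂ) ∣
      MvPolynomial.X 1 := by
    rintro ⟨k, hk⟩
    simpa using congrArg (MvPolynomial.eval ![1, 1]) hk
  have hzero : ¬ MvPolynomial.X 0 ∣ F.1 :=
    hp0.not_dvd_of_lattesMap_fst h01 (hne hp0) hg h1
  obtain ⟨hinf, R, hR⟩ :=
    hp1.not_dvd_and_dvd_of_lattesMap_snd h10 (hne hp1) hg h1 h2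
  -- The change `(z - w, -w)` moves the parameter `t = 1` to `0` and preserves common divisors, so
  -- the criterion for `t₁` applies with `t₂ - t₁` in its place.
  have hone : ¬ (MvPolynomial.X 1 - MvPolynomial.X 0) ∣ F.1 - F.2 := by
    have hl := lattesMap_sub (MvPolynomial.X 0) (MvPolynomial.X 1) C.1 C.2
    have hl1 := congrArg Prod.fst hl
    have hl2 := congrArg Prod.snd hl
    simp only at hl1 hl2
    refine hps.not_dvd_of_lattesMap_fst hs1 (z := C.1 - C.2) (w := -C.2) (g := g) ?_ ?_ ?_
    · intro hd hd2
      rw [dvd_neg] at hd2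
      exact hne hps ((dvd_sub_left hd2).mp hd) hd2
    · intro k hk1 hk2
      rw [hl1] at hk1
      rw [hl2, dvd_neg] at hk2
      exact hg k ((dvd_sub_left hk2).mp hk1) hk2
    · rw [hl1, mul_sub, h1, h2]
      rfl
  have hF1 : F.1 ≠ 0 := fun h => hzero (h ▸ dvd_zero _)
  have hF2 : F.2 ≠ 0 := fun h => hsnd (by rw [← h2, h, mul_zero])
  obtain ⟨k, l, hk, hl, hkl⟩ := (h1 ▸ hm.lattes.1 : (g * F.1).IsHomogeneous _).exists_of_mul hg0 hF1
  obtain ⟨k', l', hk', hl', hkl'⟩ :=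
    (h2 ▸ hm.lattes.2 : (g * F.2).IsHomogeneous _).exists_of_mul hg0 hF2
  obtain rfl := hk.inj_right hk' hg0
  obtain rfl : l = l' := by omega
  have hR0 : R ≠ 0 := fun h => hF2 (by rw [hR, h, mul_zero])
  obtain ⟨i, e, hi, he, hie⟩ :=
    (hR ▸ hl' : (MvPolynomial.X 1 * R).IsHomogeneous _).exists_of_mul (MvPolynomial.X_ne_zero 1) hR0
  obtain rfl := hi.inj_right (MvPolynomial.isHomogeneous_X ℂ (1 : Fin 2)) (MvPolynomial.X_ne_zero 1)
  obtain rfl : e + 1 = l := by omega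
  -- A form vanishing at one of the three points is divisible by the corresponding linear form `t₂`,
  -- `t₁` or `t₂ - t₁`, which has been excluded.
  refine ⟨R, e, hR, hl, he, hrel, fun h => hinf ?_, fun h => hzero ?_, fun h => hone ?_⟩
  · simpa using hl.linear_dvd (t := ![1, 0]) (by simp) h
  · simpa using hl.linear_dvd (t := ![0, 1]) (by simp) h
  · have := (hl.sub hl').linear_dvd (t := ![1, 1]) (by simp)
      (by rw [map_sub]; exact sub_eq_zero.mpr h)
    rw [← neg_sub, neg_dvd]
    simpa using this

/-- The Lattès step `(P, t₂ R) ↦ F(P, t₂ R) / t₂²` expressed in terms of `(P, R)`. -/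
noncomputable def reducedIter (P R : MvPolynomial (Fin 2) ℂ) : ℕ → PolyPair
  | 0 => (P, R)
  | n + 1 =>
    let F := reducedIter P R n
    ((MvPolynomial.X 0 * MvPolynomial.X 1 * F.2 ^ 2 - F.1 ^ 2) ^ 2,
      4 * F.1 * F.2 * (MvPolynomial.X 1 * F.2 - F.1) * (MvPolynomial.X 0 * F.2 - F.1))

theorem lattes_mul_X (P R : MvPolynomial (Fin 2) ℂ) :
    lattes (P, MvPolynomial.X 1 * R) =
      (MvPolynomial.X 1 ^ 2 * (MvPolynomial.X 0 * MvPolynomial.X 1 * R ^ 2 - P ^ 2) ^ 2,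
        MvPolynomial.X 1 ^ 2 * (MvPolynomial.X 1 *
          (4 * P * R * (MvPolynomial.X 1 * R - P) * (MvPolynomial.X 0 * R - P)))) := by
  ext1 <;> simp only [lattes, lattesMap] <;> ring

theorem divT₂Sq_mul (P Q : MvPolynomial (Fin 2) ℂ) :
    divT₂Sq (MvPolynomial.X 1 ^ 2 * P, MvPolynomial.X 1 ^ 2 * Q) = (P, Q) := by
  simp only [divT₂Sq, MvPolynomial.X_pow_eq_monomial, MvPolynomial.divMonomial_monomial_mul]

theorem iter_eq_reducedIter {F : PolyPair} {R : MvPolynomial (Fin 2) ℂ}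
    (hF : F.2 = MvPolynomial.X 1 * R) (n : ℕ) :
    F.iter n = ((reducedIter F.1 R n).1, MvPolynomial.X 1 * (reducedIter F.1 R n).2) := by
  induction n with
  | zero => simp only [iter, reducedIter, ← hF]
  | succ n ih => rw [iter, ih, lattes_mul_X, divT₂Sq_mul]; rfl

theorem lattes_iter {F : PolyPair} {R : MvPolynomial (Fin 2) ℂ}
    (hF : F.2 = MvPolynomial.X 1 * R) (n : ℕ) :
    (F.iter n).lattes = (MvPolynomial.X 1 ^ 2 * (F.iter (n + 1)).1,
      MvPolynomial.X 1 ^ 2 * (F.iter (n + 1)).2) := by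
  rw [iter_eq_reducedIter hF n, iter_eq_reducedIter hF (n + 1), lattes_mul_X]
  rfl

theorem reducedIter_isHomogeneous {P R : MvPolynomial (Fin 2) ℂ} {e : ℕ}
    (hP : P.IsHomogeneous (e + 1)) (hR : R.IsHomogeneous e) (n : ℕ) :
    ∃ k, k + 1 = 4 ^ n * (e + 1) ∧ (reducedIter P R n).1.IsHomogeneous (k + 1) ∧
      (reducedIter P R n).2.IsHomogeneous k := by
  have h0 := MvPolynomial.isHomogeneous_X ℂ (0 : Fin 2)
  have h1 := MvPolynomial.isHomogeneous_X ℂ (1 : Fin 2)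
  have h4 : (4 : MvPolynomial (Fin 2) ℂ).IsHomogeneous 0 := MvPolynomial.isHomogeneous_C _ (4 : ℂ)
  induction n with
  | zero => exact ⟨e, by simp, hP, hR⟩
  | succ n ih =>
    obtain ⟨k, hk, hP, hR⟩ := ih
    refine ⟨4 * k + 3, by rw [pow_succ', mul_assoc, ← hk]; ring, ?_, ?_⟩
    · have ha := (h0.mul h1).mul (hR.pow 2)
      have hb := hP.pow 2
      rw [show 1 + 1 + k * 2 = (k + 1) * 2 by ring] at ha
      have h := (ha.sub hb).pow 2
      rw [show (k + 1) * 2 * 2 = 4 * k + 3 + 1 by ring] at h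
      exact h
    · have ha := h1.mul hR
      have hb := h0.mul hR
      rw [add_comm] at ha hb
      convert (((h4.mul hP).mul hR).mul (ha.sub hP)).mul (hb.sub hP) using 1
      · rfl
      · ring

end PolyPair

/-! ### Growth of orbits of the one-parameter family. -/

section LattesOrbit

/-- The first entry is small compared with `N⁴` only when `s w² ≈ z²`. Then `|w|` exceeds `|z|`,
which in turn exceeds `|s w|`, both by definite factors, so no factor of the second entry
degenerates and that entry, weighted by `s`, has size at least `|z|⁴ / 8`. -/
theorem lattesMap_one_lower_bound {s z w : ℂ} (hs : ‖s‖ ≤ 1 / 4) :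
    max ‖z‖ ‖s * w‖ ^ 4 ≤
      8 * max ‖(lattesMap s 1 (z, w)).1‖ ‖s * (lattesMap s 1 (z, w)).2‖ := by
  have hp : ‖s * w ^ 2‖ = ‖s‖ * ‖w‖ ^ 2 := by simp
  have hq : ‖s * w‖ ^ 2 = ‖s‖ * ‖s * w ^ 2‖ := by simp; ring
  have hs0 := norm_nonneg s
  have hz0 := norm_nonneg z
  have hw0 := norm_nonneg w
  have hsw0 := norm_nonneg (s * w)
  have hp0 := norm_nonneg (s * w ^ 2)
  have hz2 : ‖z ^ 2‖ = ‖z‖ ^ 2 := norm_pow z 2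
  have h1 : ‖(lattesMap s 1 (z, w)).1‖ = ‖s * w ^ 2 - z ^ 2‖ ^ 2 := by simp [lattesMap]
  have hsub := norm_sub_norm_le (s * w ^ 2) (z ^ 2)
  rcases le_total ‖z‖ ‖s * w‖ with h | h
  · rw [max_eq_right h]
    refine le_trans ?_ (mul_le_mul_of_nonneg_left (le_max_left _ _) (by norm_num))
    rw [h1]
    -- Since `|s w|² = |s| |s w²|` and `|s| ≤ 1/4`.
    have h4 : 4 * ‖s * w‖ ^ 2 ≤ ‖s * w ^ 2‖ := by nlinarith
    have hz : ‖z‖ ^ 2 ≤ ‖s * w‖ ^ 2 := by gcongr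
    have h3 : ‖s * w‖ ^ 2 ≤ ‖s * w ^ 2 - z ^ 2‖ := by nlinarith
    nlinarith [sq_nonneg (‖s * w‖ ^ 2)]
  · rw [max_eq_left h]
    by_cases hd : ‖z‖ ^ 2 / 2 ≤ ‖s * w ^ 2 - z ^ 2‖
    · refine le_trans ?_ (mul_le_mul_of_nonneg_left (le_max_left _ _) (by norm_num))
      rw [h1]
      nlinarith [sq_nonneg (‖z‖ ^ 2)]
    · push Not at hd
      refine le_trans ?_ (mul_le_mul_of_nonneg_left (le_max_right _ _) (by norm_num))
      have hsub' := norm_sub_norm_le (z ^ 2) (s * w ^ 2)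
      rw [norm_sub_rev] at hsub'
      rw [hz2] at hsub hsub'
      have hp1 : ‖z‖ ^ 2 / 2 ≤ ‖s * w ^ 2‖ := by linarith
      have hp2 : ‖s * w ^ 2‖ ≤ 3 / 2 * ‖z‖ ^ 2 := by linarith
      have hw2 : 2 * ‖z‖ ^ 2 ≤ ‖w‖ ^ 2 := by nlinarith [sq_nonneg ‖w‖]
      have hw : 4 / 3 * ‖z‖ ≤ ‖w‖ := by
        refine le_of_sq_le_sq ?_ hw0
        nlinarith [sq_nonneg ‖z‖]
      have hsw : ‖s * w‖ ≤ 3 / 4 * ‖z‖ := by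
        refine le_of_sq_le_sq ?_ (by positivity)
        nlinarith [sq_nonneg ‖z‖]
      have ha : ‖w‖ / 4 ≤ ‖w - z‖ := by linarith [norm_sub_norm_le w z]
      have hb : ‖z‖ / 4 ≤ ‖s * w - z‖ := by
        linarith [norm_sub_norm_le z (s * w), norm_sub_rev z (s * w)]
      have h2 : ‖s * (lattesMap s 1 (z, w)).2‖ =
          4 * ‖z‖ * (‖s‖ * ‖w‖) * ‖w - z‖ * ‖s * w - z‖ := by
        simp [lattesMap]
        ring
      rw [h2]
      calc ‖z‖ ^ 4 = 2 * ‖z‖ ^ 2 * (‖z‖ ^ 2 / 2) := by ring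
        _ ≤ 2 * ‖z‖ ^ 2 * (‖s‖ * ‖w‖ ^ 2) := by
            rw [← hp]
            gcongr
        _ = 8 * (4 * ‖z‖ * (‖s‖ * ‖w‖) * (‖w‖ / 4) * (‖z‖ / 4)) := by ring
        _ ≤ _ := by gcongr

theorem lattesMap_one_upper_bound {s z w : ℂ} (hs : ‖s‖ ≤ 1 / 4) {a : ℝ} (ha : 1 ≤ a)
    (hw : ‖w‖ ≤ a * max ‖z‖ ‖s * w‖) :
    max ‖(lattesMap s 1 (z, w)).1‖ ‖s * (lattesMap s 1 (z, w)).2‖ ≤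
        16 * a ^ 2 * max ‖z‖ ‖s * w‖ ^ 4 ∧
      ‖(lattesMap s 1 (z, w)).2‖ ≤ 16 * a ^ 2 * max ‖z‖ ‖s * w‖ ^ 4 := by
  set N := max ‖z‖ ‖s * w‖ with hN
  have hz : ‖z‖ ≤ N := le_max_left _ _
  have hsw : ‖s * w‖ ≤ N := le_max_right _ _
  have hN0 : 0 ≤ N := (norm_nonneg z).trans hz
  have hz2 : ‖z ^ 2‖ ≤ N ^ 2 := by rw [norm_pow]; gcongr
  have hsw2 : ‖s * w ^ 2‖ ≤ a * N ^ 2 := by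
    rw [show s * w ^ 2 = s * w * w by ring, norm_mul]
    calc ‖s * w‖ * ‖w‖ ≤ N * (a * N) := by gcongr
      _ = a * N ^ 2 := by ring
  have h1 : ‖(lattesMap s 1 (z, w)).1‖ ≤ 16 * a ^ 2 * N ^ 4 := by
    simp only [lattesMap, one_mul, norm_pow]
    have : ‖s * w ^ 2 - z ^ 2‖ ≤ 2 * a * N ^ 2 := by
      have := norm_sub_le (s * w ^ 2) (z ^ 2)
      nlinarith [sq_nonneg N]
    calc ‖s * w ^ 2 - z ^ 2‖ ^ 2 ≤ (2 * a * N ^ 2) ^ 2 := by gcongr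
      _ ≤ 16 * a ^ 2 * N ^ 4 := by nlinarith [sq_nonneg (a * N ^ 2)]
  have h2 : ‖(lattesMap s 1 (z, w)).2‖ ≤ 16 * a ^ 2 * N ^ 4 := by
    have hwz : ‖w - z‖ ≤ 2 * a * N := by
      have := norm_sub_le w z
      nlinarith
    have hswz : ‖s * w - z‖ ≤ 2 * N := by
      have := norm_sub_le (s * w) z
      linarith
    simp only [lattesMap, mul_one, one_mul, norm_mul, Complex.norm_ofNat]
    calc 4 * ‖z‖ * ‖w‖ * ‖w - z‖ * ‖s * w - z‖ ≤ 4 * N * (a * N) * (2 * a * N) * (2 * N) := by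
          gcongr
      _ = 16 * a ^ 2 * N ^ 4 := by ring
  refine ⟨max_le h1 ?_, h2⟩
  rw [norm_mul]
  exact (mul_le_of_le_one_left (norm_nonneg _) (by linarith)).trans h2

theorem lattesMap_orbit_estimate {s : ℂ} (hs : ‖s‖ ≤ 1 / 4) {p : ℕ → ℂ × ℂ}
    (hp : ∀ n, p (n + 1) = lattesMap s 1 (p n)) {a : ℝ} (ha : 1 ≤ a) (h0 : (p 0).1 ≠ 0)
    (hpa : ‖(p 0).2‖ ≤ a * ‖(p 0).1‖) (n : ℕ) :
    0 < max ‖(p n).1‖ ‖s * (p n).2‖ ∧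
      |Real.log (max ‖(p (n + 1)).1‖ ‖s * (p (n + 1)).2‖) -
        4 * Real.log (max ‖(p n).1‖ ‖s * (p n).2‖)| ≤ 2 * Real.log (128 * a) * 2 ^ n ∧
      |Real.log ‖p n‖ - Real.log (max ‖(p n).1‖ ‖s * (p n).2‖)| ≤ Real.log (128 * a) * 2 ^ n := by
  set N : ℕ → ℝ := fun n => max ‖(p n).1‖ ‖s * (p n).2‖ with hN
  -- The solution of `A (n + 1) = 128 * A n ^ 2` with `A 0 = a`. The factor `128 = 16 · 8` combines
  -- the constants of the upper and lower bounds.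
  set A : ℕ → ℝ := fun n => (128 * a) ^ 2 ^ n / 128 with hA
  have hA1 : ∀ n, 1 ≤ A n := fun n => by
    rw [hA]
    have := le_self_pow₀ (show 1 ≤ 128 * a by linarith) (show 2 ^ n ≠ 0 by positivity)
    simp only
    linarith
  have hAs : ∀ n, A (n + 1) = 128 * A n ^ 2 := fun n => by
    simp only [hA, pow_succ 2 n, pow_mul]
    ring
  have hlow : ∀ n, N n ^ 4 ≤ 8 * N (n + 1) := fun n => by
    simp only [hN, hp n]
    exact lattesMap_one_lower_bound hs
  have hinv : ∀ n, 0 < N n ∧ ‖(p n).2‖ ≤ A n * N n := by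
    intro n
    induction n with
    | zero =>
      refine ⟨lt_max_of_lt_left (norm_pos_iff.mpr h0), ?_⟩
      have h1 : A 0 = a := by simp [hA]
      rw [h1]
      exact hpa.trans (mul_le_mul_of_nonneg_left (le_max_left _ _) (by linarith))
    | succ n ih =>
      have hl := hlow n
      have hpos : 0 < N n ^ 4 := pow_pos ih.1 4
      refine ⟨by linarith, ?_⟩
      have h2 := (lattesMap_one_upper_bound hs (hA1 n) ih.2).2
      rw [hp n, hAs]
      refine h2.trans ?_
      calc 16 * A n ^ 2 * N n ^ 4 ≤ 16 * A n ^ 2 * (8 * N (n + 1)) := by gcongr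
        _ = _ := by ring
  have hb : 0 ≤ Real.log (128 * a) := Real.log_nonneg (by linarith)
  have hlogpow : ∀ k : ℕ, Real.log ((128 * a) ^ k) = k * Real.log (128 * a) := fun k =>
    Real.log_pow _ k
  have h128 : (0 : ℝ) < 128 * a := by linarith
  have h2n : (1 : ℝ) ≤ 2 ^ n := one_le_pow₀ (by norm_num)
  obtain ⟨hNpos, hw⟩ := hinv n
  have hNpos' := (hinv (n + 1)).1
  refine ⟨hNpos, ?_, ?_⟩
  · have hup : N (n + 1) ≤ 16 * A n ^ 2 * N n ^ 4 := by
      simp only [hN, hp n]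
      exact (lattesMap_one_upper_bound hs (hA1 n) hw).1
    have hup' : N (n + 1) ≤ (128 * a) ^ (2 ^ n * 2) * N n ^ 4 := by
      refine hup.trans (mul_le_mul_of_nonneg_right ?_ (by positivity))
      simp only [hA, pow_mul]
      nlinarith [sq_nonneg ((128 * a) ^ 2 ^ n)]
    have hlow' : N n ^ 4 ≤ (128 * a) * N (n + 1) :=
      (hlow n).trans (mul_le_mul_of_nonneg_right (by linarith) hNpos'.le)
    have l1 := Real.log_le_log hNpos' hup'
    rw [Real.log_mul (by positivity) (by positivity), hlogpow, Real.log_pow] at l1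
    have l2 := Real.log_le_log (by positivity) hlow'
    rw [Real.log_mul h128.ne' hNpos'.ne', Real.log_pow] at l2
    push_cast at l1 l2
    rw [abs_le]
    constructor <;> nlinarith
  · have hle : N n ≤ ‖p n‖ := by
      rw [Prod.norm_def]
      refine max_le_max le_rfl ?_
      rw [norm_mul]
      exact mul_le_of_le_one_left (norm_nonneg _) (by linarith)
    have hge : ‖p n‖ ≤ (128 * a) ^ 2 ^ n * N n := by
      have h1 : A n ≤ (128 * a) ^ 2 ^ n := div_le_self (by positivity) (by norm_num)
      rw [Prod.norm_def]
      refine max_le ?_ (hw.trans (by gcongr))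
      refine (le_max_left _ ‖s * (p n).2‖).trans ?_
      exact le_mul_of_one_le_left hNpos.le ((hA1 n).trans h1)
    have l1 := Real.log_le_log hNpos hle
    have l2 := Real.log_le_log (hNpos.trans_le hle) hge
    rw [Real.log_mul (by positivity) hNpos.ne', hlogpow] at l2
    push_cast at l2
    rw [abs_le]
    constructor <;> nlinarith

/-- A sequence of positive numbers growing like `exp (4 ^ n)`, up to an error `C 2 ^ n` in the
logarithms of consecutive terms. -/
def QuarticGrowth (C : ℝ) (f : ℕ → ℝ) : Prop :=
  ∀ n, 0 < f n ∧ |Real.log (f (n + 1)) - 4 * Real.log (f n)| ≤ C * 2 ^ n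

theorem QuarticGrowth.of_abs_log_sub_le {C D : ℝ} {f g : ℕ → ℝ} (hg : QuarticGrowth C g)
    (hf : ∀ n, 0 < f n) (h : ∀ n, |Real.log (f n) - Real.log (g n)| ≤ D * 2 ^ n) :
    QuarticGrowth (C + 6 * D) f := by
  intro n
  refine ⟨hf n, ?_⟩
  have h1 := abs_le.mp (hg n).2
  have h2 := abs_le.mp (h n)
  have h3 := abs_le.mp (h (n + 1))
  rw [pow_succ] at h3
  rw [abs_le]
  constructor <;> linarith

/-- An error `C 2ⁿ` divided by `4ⁿ⁺¹` is still geometrically small, so the normalized logarithms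
form a Cauchy sequence at a rate depending only on `C`. -/
theorem QuarticGrowth.dist_le {C : ℝ} {f : ℕ → ℝ} (hf : QuarticGrowth C f) (n : ℕ) :
    dist (Real.log (f n) / 4 ^ n) (Real.log (f (n + 1)) / 4 ^ (n + 1)) ≤ C * (1 / 2) ^ n := by
  have h := (hf n).2
  have hC : 0 ≤ C * 2 ^ n := (abs_nonneg _).trans h
  have h2 : (4 : ℝ) ^ n = 2 ^ n * 2 ^ n := by rw [← mul_pow]; norm_num
  rw [dist_comm, Real.dist_eq, show Real.log (f (n + 1)) / 4 ^ (n + 1) - Real.log (f n) / 4 ^ n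
    = (Real.log (f (n + 1)) - 4 * Real.log (f n)) / 4 ^ (n + 1) by field_simp; ring,
    abs_div, abs_of_pos (show (0 : ℝ) < 4 ^ (n + 1) by positivity), div_le_iff₀ (by positivity)]
  refine h.trans ?_
  have : C * (1 / 2) ^ n * 4 ^ (n + 1) = 4 * (C * 2 ^ n) := by
    rw [pow_succ, h2, one_div, inv_pow]
    field_simp
  linarith

theorem lattesMap_zero_orbit_fst {p : ℕ → ℂ × ℂ} (hp : ∀ n, p (n + 1) = lattesMap 0 1 (p n))
    (n : ℕ) : (p n).1 = (p 0).1 ^ 4 ^ n := by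
  induction n with
  | zero => simp
  | succ n ih =>
    rw [hp, pow_succ 4 n, pow_mul, ← ih]
    simp only [lattesMap]
    ring

/-- Uniform estimates for the orbits of the Lattès family near the degenerate parameter `0`. -/
theorem eventually_lattesMap_orbit_estimate {T : Type*} [TopologicalSpace T] {t₀ : T} {s : T → ℂ}
    (hs : ContinuousAt s t₀) (hs0 : s t₀ = 0) {p : ℕ → T → ℂ × ℂ}
    (hp : ∀ᶠ t in nhds t₀, ∀ n, p (n + 1) t = lattesMap (s t) 1 (p n t))
    (hp0 : ContinuousAt (p 0) t₀) (h0 : (p 0 t₀).1 ≠ 0) :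
    ∃ b : ℝ, 0 ≤ b ∧ ∀ᶠ t in nhds t₀,
      QuarticGrowth (2 * b) (fun n => max ‖(p n t).1‖ ‖s t * (p n t).2‖) ∧
      ∀ n, |Real.log ‖p n t‖ - Real.log (max ‖(p n t).1‖ ‖s t * (p n t).2‖)| ≤ b * 2 ^ n := by
  have hz := norm_pos_iff.mpr h0
  set a : ℝ := 1 + ‖(p 0 t₀).2‖ / ‖(p 0 t₀).1‖ with ha
  have ha1 : 1 ≤ a := le_add_of_nonneg_right (by positivity)
  refine ⟨Real.log (128 * a), Real.log_nonneg (by linarith), ?_⟩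
  have e1 : ∀ᶠ t in nhds t₀, ‖(p 0 t).2‖ < a * ‖(p 0 t).1‖ := by
    refine ContinuousAt.eventually_lt hp0.snd.norm (hp0.fst.norm.const_mul a) ?_
    rw [ha, add_mul, one_mul, div_mul_cancel₀ _ hz.ne']
    linarith
  have e2 : ∀ᶠ t in nhds t₀, (p 0 t).1 ≠ 0 := hp0.fst.eventually_ne h0
  have e3 : ∀ᶠ t in nhds t₀, ‖s t‖ < 1 / 4 :=
    ContinuousAt.eventually_lt hs.norm continuousAt_const (by simp [hs0])
  filter_upwards [hp, e1, e2, e3] with t h h1 h2 h3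
  have key := lattesMap_orbit_estimate h3.le (p := fun n => p n t) h ha1 h2 h1.le
  exact ⟨fun n => ⟨(key n).1, (key n).2.1⟩, fun n => (key n).2.2⟩

theorem lattesMap_smul {R : Type*} [CommRing R] (t₁ t₂ c : R) (p : R × R) :
    lattesMap t₁ t₂ (c • p) = c ^ 4 • lattesMap t₁ t₂ p := by
  ext <;> simp only [lattesMap, Prod.smul_fst, Prod.smul_snd, smul_eq_mul] <;> ring

theorem lattesMap_one_ne_zero {s : ℂ} (h0 : s ≠ 0) (h1 : s ≠ 1) {p : ℂ × ℂ} (hp : p ≠ 0) :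
    lattesMap s 1 p ≠ 0 := by
  obtain ⟨z, w⟩ := p
  intro h
  simp only [lattesMap, Prod.mk_eq_zero, one_mul, mul_one, mul_eq_zero, pow_eq_zero_iff,
    ne_eq, OfNat.ofNat_ne_zero, not_false_eq_true, false_or] at h
  obtain ⟨ha, hb⟩ := h
  have key : z = 0 ∧ w = 0 := by
    rcases hb with ((rfl | rfl) | hb) | hb
    · simpa [h0] using ha
    · simpa using ha
    · obtain rfl := sub_eq_zero.mp hb
      have : (s - 1) * w ^ 2 = 0 := by linear_combination ha
      simpa [sub_ne_zero.mpr h1] using this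
    · obtain rfl := sub_eq_zero.mp hb
      have : s * (1 - s) * w ^ 2 = 0 := by linear_combination ha
      have hw : w = 0 := by simpa [h0, sub_ne_zero.mpr h1.symm] using this
      simp [hw]
  exact hp (by rw [key.1, key.2]; rfl)

/-- By homogeneity it suffices to bound `|log‖F_{s,1}‖|` on the unit sphere for `s` in a small
closed ball avoiding `0` and `1`. This set is compact and the map has no zero on it. -/
theorem eventually_quarticGrowth_lattesMap {T : Type*} [TopologicalSpace T] {t₀ : T} {s : T → ℂ}
    (hs : ContinuousAt s t₀) (hs0 : s t₀ ≠ 0) (hs1 : s t₀ ≠ 1) {p : ℕ → T → ℂ × ℂ}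
    (hp : ∀ᶠ t in nhds t₀, ∀ n, p (n + 1) t = lattesMap (s t) 1 (p n t))
    (hp0 : ContinuousAt (p 0) t₀) (h0 : p 0 t₀ ≠ 0) :
    ∃ C : ℝ, ∀ᶠ t in nhds t₀, QuarticGrowth C (fun n => ‖p n t‖) := by
  obtain ⟨r, hr, hball⟩ := Metric.nhds_basis_closedBall.mem_iff.mp
    (((isOpen_ne (x := (0 : ℂ))).inter (isOpen_ne (x := (1 : ℂ)))).mem_nhds ⟨hs0, hs1⟩)
  set K : Set (ℂ × (ℂ × ℂ)) := Metric.closedBall (s t₀) r ×ˢ Metric.sphere 0 1 with hK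
  have hKc : IsCompact K := (isCompact_closedBall _ _).prod (isCompact_sphere _ _)
  have hcont : Continuous fun x : ℂ × (ℂ × ℂ) => lattesMap x.1 1 x.2 := by
    unfold lattesMap
    fun_prop
  have hlog : ContinuousOn (fun x : ℂ × (ℂ × ℂ) => |Real.log ‖lattesMap x.1 1 x.2‖|) K := by
    refine (ContinuousOn.log hcont.norm.continuousOn fun x hx => ?_).abs
    refine norm_ne_zero_iff.mpr (lattesMap_one_ne_zero (hball hx.1).1 (hball hx.1).2 ?_)
    exact ne_zero_of_mem_unit_sphere (⟨x.2, hx.2⟩ : Metric.sphere (0 : ℂ × ℂ) 1)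
  obtain ⟨C, hC⟩ := (hKc.bddAbove_image hlog)
  refine ⟨C, ?_⟩
  have e1 : ∀ᶠ t in nhds t₀, s t ∈ Metric.closedBall (s t₀) r :=
    hs.eventually (Metric.closedBall_mem_nhds _ hr)
  filter_upwards [hp, e1, hp0.eventually_ne h0] with t h ht hne
  have hpos : ∀ n, 0 < ‖p n t‖ := by
    intro n
    rw [norm_pos_iff]
    induction n with
    | zero => exact hne
    | succ n ih => rw [h n]; exact lattesMap_one_ne_zero (hball ht).1 (hball ht).2 ih
  intro n
  refine ⟨hpos n, ?_⟩
  have hn := (hpos n).ne'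
  set q : ℂ × ℂ := ((‖p n t‖⁻¹ : ℝ) : ℂ) • p n t with hq
  have hq1 : ‖q‖ = 1 := by
    rw [hq, norm_smul, Complex.norm_real, norm_inv, norm_norm, inv_mul_cancel₀ hn]
  have hpq : p n t = ((‖p n t‖ : ℝ) : ℂ) • q := by
    rw [hq, smul_smul, ← Complex.ofReal_mul, mul_inv_cancel₀ hn, Complex.ofReal_one, one_smul]
  have hmem : (s t, q) ∈ K := ⟨ht, by simpa using hq1⟩
  have hbound := hC ⟨_, hmem, rfl⟩
  simp only at hbound
  have hnorm : ‖p (n + 1) t‖ = ‖p n t‖ ^ 4 * ‖lattesMap (s t) 1 q‖ := by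
    rw [h n]
    conv_lhs => rw [hpq]
    rw [lattesMap_smul, norm_smul, norm_pow, Complex.norm_real, norm_norm]
  have hne' : ‖lattesMap (s t) 1 q‖ ≠ 0 := fun h0 => by
    have := hpos (n + 1)
    rw [hnorm, h0, mul_zero] at this
    exact this.false
  change |Real.log ‖p (n + 1) t‖ - 4 * Real.log ‖p n t‖| ≤ C * 2 ^ n
  rw [hnorm, Real.log_mul (pow_ne_zero 4 hn) hne', Real.log_pow]
  push_cast
  rw [add_sub_cancel_left]
  exact hbound.trans (le_mul_of_one_le_right ((abs_nonneg _).trans hbound)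
    (one_le_pow₀ (by norm_num)))

end LattesOrbit

/-! ### From growth estimates to limits. -/

/-- The common form of the three degenerate cases. The function `f` will be `‖F_n‖` in the original
coordinates, and the factors `2` leave room for the coordinate change at `t = 1`. -/
theorem quarticGrowth_and_tendsto_of_degenerate {T : Type*} [TopologicalSpace T] {t₀ : T}
    {s : T → ℂ} (hs : ContinuousAt s t₀) (hs0 : s t₀ = 0) {p : ℕ → T → ℂ × ℂ}
    (hp : ∀ᶠ t in nhds t₀, ∀ n, p (n + 1) t = lattesMap (s t) 1 (p n t))
    (hp0 : ContinuousAt (p 0) t₀) (h0 : (p 0 t₀).1 ≠ 0) {f : ℕ → T → ℝ}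
    (hf : ∀ᶠ t in nhds t₀, ∀ n,
      max ‖(p n t).1‖ ‖s t * (p n t).2‖ ≤ 2 * f n t ∧ f n t ≤ 2 * ‖p n t‖) :
    (∃ C : ℝ, ∀ᶠ t in nhds t₀, QuarticGrowth C (fun n => f n t)) ∧
      Filter.Tendsto (fun n => Real.log (f n t₀) / 4 ^ n) Filter.atTop
        (nhds (Real.log ‖(p 0 t₀).1‖)) := by
  obtain ⟨b, hb, hest⟩ := eventually_lattesMap_orbit_estimate hs hs0 hp hp0 h0
  have key : ∀ᶠ t in nhds t₀,
      QuarticGrowth (2 * b) (fun n => max ‖(p n t).1‖ ‖s t * (p n t).2‖) ∧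
      (∀ n, 0 < f n t) ∧ ∀ n, |Real.log (f n t) -
        Real.log (max ‖(p n t).1‖ ‖s t * (p n t).2‖)| ≤ (b + Real.log 2) * 2 ^ n := by
    filter_upwards [hest, hf] with t ⟨h1, h2⟩ h3
    have hpos : ∀ n, 0 < f n t := fun n => by linarith [(h1 n).1, (h3 n).1]
    refine ⟨h1, hpos, fun n => ?_⟩
    have hppos : 0 < ‖p n t‖ := by linarith [hpos n, (h3 n).2]
    have l1 := Real.log_le_log (h1 n).1 (h3 n).1
    have l2 := Real.log_le_log (hpos n) (h3 n).2
    rw [Real.log_mul two_ne_zero (hpos n).ne'] at l1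
    rw [Real.log_mul two_ne_zero hppos.ne'] at l2
    have h4 := abs_le.mp (h2 n)
    have h5 : Real.log 2 ≤ Real.log 2 * 2 ^ n :=
      le_mul_of_one_le_right (Real.log_nonneg one_le_two) (one_le_pow₀ one_le_two)
    have h6 : 0 ≤ b * 2 ^ n := by positivity
    rw [abs_le]
    constructor <;> linarith
  refine ⟨⟨_, key.mono fun t ht => ht.1.of_abs_log_sub_le ht.2.1 ht.2.2⟩, ?_⟩
  have hself := key.self_of_nhds.2.2
  have horb := lattesMap_zero_orbit_fst (p := fun n => p n t₀)
    (fun n => by rw [hp.self_of_nhds n, hs0])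
  have hlim : Filter.Tendsto (fun n : ℕ => (b + Real.log 2) * (1 / 2 : ℝ) ^ n) Filter.atTop
      (nhds 0) := by
    simpa using (tendsto_pow_atTop_nhds_zero_of_lt_one (by norm_num : (0 : ℝ) ≤ 1 / 2)
      (by norm_num)).const_mul (b + Real.log 2)
  refine tendsto_iff_dist_tendsto_zero.mpr (squeeze_zero (fun _ => dist_nonneg) (fun n => ?_) hlim)
  have h := hself n
  rw [hs0, zero_mul, norm_zero, max_eq_left (norm_nonneg _), horb n, norm_pow, Real.log_pow] at h
  push_cast at h
  have h4 : (0 : ℝ) < 4 ^ n := by positivity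
  rw [Real.dist_eq, show Real.log (f n t₀) / 4 ^ n - Real.log ‖(p 0 t₀).1‖
    = (Real.log (f n t₀) - 4 ^ n * Real.log ‖(p 0 t₀).1‖) / 4 ^ n by field_simp,
    abs_div, abs_of_pos h4, div_le_iff₀ h4]
  refine h.trans_eq ?_
  rw [mul_assoc, ← mul_pow]
  norm_num

theorem exists_tendstoLocallyUniformlyOn_of_quarticGrowth {T : Type*} [TopologicalSpace T]
    {Ω : Set T} {f : ℕ → T → ℝ}
    (h : ∀ t₀ ∈ Ω, ∃ C : ℝ, ∀ᶠ t in nhds t₀, QuarticGrowth C (fun n => f n t)) :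
    ∃ G : T → ℝ, TendstoLocallyUniformlyOn (fun n t => Real.log (f n t) / 4 ^ n) G
      Filter.atTop Ω := by
  refine ⟨fun t => Filter.limUnder Filter.atTop fun n => Real.log (f n t) / 4 ^ n, ?_⟩
  rw [Metric.tendstoLocallyUniformlyOn_iff]
  intro ε hε t₀ ht₀
  obtain ⟨C, hC⟩ := h t₀ ht₀
  refine ⟨_, mem_nhdsWithin_of_mem_nhds hC, ?_⟩
  have hlim : Filter.Tendsto (fun n : ℕ => C * (1 / 2 : ℝ) ^ n / (1 - 1 / 2)) Filter.atTop
      (nhds 0) := by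
    simpa using ((tendsto_pow_atTop_nhds_zero_of_lt_one (by norm_num : (0 : ℝ) ≤ 1 / 2)
      (by norm_num)).const_mul C).div_const (1 - 1 / 2)
  filter_upwards [hlim.eventually_lt_const hε] with n hn t ht
  have hcau := cauchySeq_of_le_geometric (1 / 2) C (by norm_num) (QuarticGrowth.dist_le ht)
  rw [dist_comm]
  exact (dist_le_of_le_geometric_of_tendsto (1 / 2) C (by norm_num) (QuarticGrowth.dist_le ht)
    hcau.tendsto_limUnder n).trans_lt hn

/-! ### Plurisubharmonicity. -/

section Plurisubharmonic

/-- In Jensen's formula every zero in the disc contributes a nonnegative term. -/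
theorem AnalyticOnNhd.log_norm_le_circleAverage {f : ℂ → ℂ}
    (hf : AnalyticOnNhd ℂ f (Metric.closedBall 0 1)) (h0 : f 0 ≠ 0) :
    Real.log ‖f 0‖ ≤ Real.circleAverage (fun ζ => Real.log ‖f ζ‖) 0 1 := by
  rw [AnalyticOnNhd.circleAverage_log_norm one_ne_zero (by rwa [abs_one]) h0]
  refine le_add_of_nonneg_left (finsum_nonneg fun u => ?_)
  rw [abs_one]
  by_cases hu : u ∈ Metric.closedBall (0 : ℂ) 1
  · refine mul_nonneg (mod_cast MeromorphicOn.AnalyticOnNhd.divisor_nonneg hf u) ?_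
    rw [one_mul, zero_sub, norm_neg, Real.log_inv, neg_nonneg]
    exact Real.log_nonpos (norm_nonneg u) (by simpa using hu)
  · rw [Function.locallyFinsuppWithin.apply_eq_zero_of_notMem _ hu]
    simp

theorem IsPlurisubharmonicOn.of_tendstoLocallyUniformlyOn {E : Type*} [NormedAddCommGroup E]
    [NormedSpace ℂ E] {u : ℕ → E → ℝ} {G : E → ℝ} {Ω : Set E}
    (hu : ∀ n, IsPlurisubharmonicOn (u n) Ω) (hc : ContinuousOn G Ω)
    (h : TendstoLocallyUniformlyOn u G Filter.atTop Ω) : IsPlurisubharmonicOn G Ω := by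
  refine ⟨hc.upperSemicontinuousOn, fun a b hab => ?_⟩
  have hline : Continuous fun ζ : ℂ => a + ζ • b := by fun_prop
  have hmaps : Set.MapsTo (fun ζ : ℂ => a + ζ • b) (Metric.closedBall 0 1) Ω :=
    fun ζ hζ => hab ζ (by simpa using hζ)
  have hsphere : ∀ ζ ∈ Metric.sphere (0 : ℂ) |1|, ζ ∈ Metric.closedBall (0 : ℂ) 1 := by
    rw [abs_one]
    exact fun ζ hζ => Metric.sphere_subset_closedBall hζ
  have hGint : CircleIntegrable (fun ζ : ℂ => G (a + ζ • b)) 0 1 :=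
    ((hc.comp hline.continuousOn hmaps).mono Metric.sphere_subset_closedBall).circleIntegrable
      zero_le_one
  refine ⟨hGint, ?_⟩
  have hK : TendstoUniformlyOn u G Filter.atTop
      ((fun ζ : ℂ => a + ζ • b) '' Metric.closedBall 0 1) :=
    (tendstoLocallyUniformlyOn_iff_tendstoUniformlyOn_of_compact
      ((isCompact_closedBall _ _).image hline)).mp (h.mono hmaps.image_subset)
  refine le_of_forall_pos_le_add fun ε hε => ?_
  obtain ⟨n, hn⟩ := ((Metric.tendstoUniformlyOn_iff.mp hK) (ε / 2) (by positivity)).exists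
  have hclose : ∀ ζ ∈ Metric.closedBall (0 : ℂ) 1,
      |G (a + ζ • b) - u n (a + ζ • b)| < ε / 2 := fun ζ hζ => hn _ ⟨ζ, hζ, rfl⟩
  have h1 := (abs_lt.mp (hclose 0 (by simp))).2
  rw [zero_smul, add_zero] at h1
  obtain ⟨hint, h2⟩ := (hu n).2 a b hab
  have h3 := Real.circleAverage_mono hint (hGint.add (circleIntegrable_const (ε / 2) 0 1))
    fun ζ hζ => by
      have := (abs_lt.mp (hclose ζ (hsphere ζ hζ))).1
      change u n (a + ζ • b) ≤ G (a + ζ • b) + ε / 2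
      linarith
  rw [Real.circleAverage_add hGint (circleIntegrable_const (ε / 2) 0 1),
    Real.circleAverage_const] at h3
  linarith

theorem IsPlurisubharmonicOn.const_mul {E : Type*} [NormedAddCommGroup E] [NormedSpace ℂ E]
    {u : E → ℝ} {Ω : Set E} (hu : IsPlurisubharmonicOn u Ω) (hc : ContinuousOn u Ω) {k : ℝ}
    (hk : 0 ≤ k) : IsPlurisubharmonicOn (fun x => k * u x) Ω := by
  refine ⟨(hc.const_mul k).upperSemicontinuousOn, fun a b hab => ?_⟩
  obtain ⟨hint, h⟩ := hu.2 a b hab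
  refine ⟨hint.const_mul k, ?_⟩
  have := Real.circleAverage_fun_smul (a := k) (f := fun ζ : ℂ => u (a + ζ • b)) (c := 0) (R := 1)
  simp only [smul_eq_mul] at this
  rw [this]
  exact mul_le_mul_of_nonneg_left h hk

namespace PolyPair

theorem continuous_eval (F : PolyPair) : Continuous F.eval :=
  (MvPolynomial.continuous_eval F.1).prodMk (MvPolynomial.continuous_eval F.2)

theorem continuousOn_log_norm_eval {F : PolyPair} {Ω : Set (Fin 2 → ℂ)}
    (hF : ∀ t ∈ Ω, F.eval t ≠ 0) : ContinuousOn (fun t => Real.log ‖F.eval t‖) Ω :=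
  F.continuous_eval.norm.continuousOn.log fun t ht => norm_ne_zero_iff.mpr (hF t ht)

theorem isPlurisubharmonicOn_log_norm_eval {F : PolyPair} {Ω : Set (Fin 2 → ℂ)}
    (hF : ∀ t ∈ Ω, F.eval t ≠ 0) : IsPlurisubharmonicOn (fun t => Real.log ‖F.eval t‖) Ω := by
  have hcont := continuousOn_log_norm_eval hF
  refine ⟨hcont.upperSemicontinuousOn, fun a b hab => ?_⟩
  have hline : Continuous fun ζ : ℂ => a + ζ • b := by fun_prop
  have hmaps : Set.MapsTo (fun ζ : ℂ => a + ζ • b) (Metric.closedBall 0 1) Ω :=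
    fun ζ hζ => hab ζ (by simpa using hζ)
  have hint : CircleIntegrable (fun ζ : ℂ => Real.log ‖F.eval (a + ζ • b)‖) 0 1 :=
    ((hcont.comp hline.continuousOn hmaps).mono Metric.sphere_subset_closedBall).circleIntegrable
      zero_le_one
  refine ⟨hint, ?_⟩
  -- To be applied to the entry that realizes the maximum norm at the centre `a`.
  have main : ∀ p : MvPolynomial (Fin 2) ℂ, MvPolynomial.eval a p ≠ 0 →
      ‖F.eval a‖ = ‖MvPolynomial.eval a p‖ → (∀ t, ‖MvPolynomial.eval t p‖ ≤ ‖F.eval t‖) →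
      Real.log ‖F.eval a‖ ≤
        Real.circleAverage (fun ζ : ℂ => Real.log ‖F.eval (a + ζ • b)‖) 0 1 := by
    intro p hp ha hle
    have han : AnalyticOnNhd ℂ (fun ζ : ℂ => MvPolynomial.eval (a + ζ • b) p) Set.univ := by
      refine (AnalyticOnNhd.eval_mvPolynomial p).comp (t := Set.univ) ?_ fun _ _ => Set.mem_univ _
      exact (Differentiable.differentiableOn (by fun_prop)).analyticOnNhd isOpen_univ
    have h1 := (han.mono (Set.subset_univ _)).log_norm_le_circleAverage (by simpa using hp)
    simp only [zero_smul, add_zero] at h1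
    -- Where `p` vanishes, `Real.log 0 = 0` may exceed `log‖F‖`. Redefining the integrand on this
    -- discrete set leaves the circle average unchanged and makes the comparison pointwise.
    set g : ℂ → ℝ := fun ζ => if MvPolynomial.eval (a + ζ • b) p = 0 then
      Real.log ‖F.eval (a + ζ • b)‖ else Real.log ‖MvPolynomial.eval (a + ζ • b) p‖ with hg
    have hpg : (fun ζ : ℂ => Real.log ‖MvPolynomial.eval (a + ζ • b) p‖)
        =ᶠ[Filter.codiscreteWithin (Metric.sphere 0 |1|)] g := by
      rcases han.eqOn_zero_or_eventually_ne_zero_of_preconnected isPreconnected_univ with h | h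
      · exact absurd (h (Set.mem_univ 0)) (by simpa using hp)
      · filter_upwards [Filter.codiscreteWithin_mono (Set.subset_univ _) h] with ζ hζ
        rw [hg]
        simp only [if_neg hζ]
    have hgint : CircleIntegrable g 0 1 := CircleIntegrable.congr_codiscreteWithin hpg
      (han.mono (Set.subset_univ _)).meromorphicOn.circleIntegrable_log_norm
    rw [ha]
    refine (h1.trans_eq (Real.circleAverage_congr_codiscreteWithin hpg one_ne_zero)).trans
      (Real.circleAverage_mono hgint hint fun ζ hζ => ?_)
    rw [hg]
    simp only
    split_ifs with h0
    · exact le_rfl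
    · exact Real.log_le_log (norm_pos_iff.mpr h0) (hle _)
  have ha0 : ‖F.eval a‖ ≠ 0 := norm_ne_zero_iff.mpr (hF a (by simpa using hab 0 (by simp)))
  rcases max_choice ‖(F.eval a).1‖ ‖(F.eval a).2‖ with h | h
  · have h' : ‖F.eval a‖ = ‖MvPolynomial.eval a F.1‖ := h
    exact main F.1 (fun h0 => ha0 (by rw [h', h0, norm_zero])) h' fun t => norm_fst_le (F.eval t)
  · have h' : ‖F.eval a‖ = ‖MvPolynomial.eval a F.2‖ := h
    exact main F.2 (fun h0 => ha0 (by rw [h', h0, norm_zero])) h' fun t => norm_snd_le (F.eval t)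

end PolyPair

end Plurisubharmonic

/-! ### Local behaviour of the iterates at each parameter. -/

namespace PolyPair

theorem eval_lattes (F : PolyPair) (t : Fin 2 → ℂ) :
    F.lattes.eval t = lattesMap (t 0) (t 1) (F.eval t) := by
  ext <;> simp [eval, lattes, lattesMap]

theorem lattesMap_div {t₁ t₂ : ℂ} (h : t₂ ≠ 0) (p : ℂ × ℂ) :
    lattesMap t₁ t₂ p = t₂ ^ 2 • lattesMap (t₁ / t₂) 1 p := by
  ext
  · simp only [lattesMap, Prod.smul_fst, smul_eq_mul]
    field_simp
  · simp only [lattesMap, Prod.smul_snd, smul_eq_mul]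
    field_simp

theorem eval_iter_succ {F : PolyPair} {R : MvPolynomial (Fin 2) ℂ}
    (hF : F.2 = MvPolynomial.X 1 * R) (n : ℕ) {t : Fin 2 → ℂ} (ht : t 1 ≠ 0) :
    (F.iter (n + 1)).eval t = lattesMap (t 0 / t 1) 1 ((F.iter n).eval t) := by
  have h1 : (F.iter n).lattes.eval t = t 1 ^ 2 • (F.iter (n + 1)).eval t := by
    rw [lattes_iter hF]
    ext <;> simp [eval]
  rw [eval_lattes, lattesMap_div ht] at h1
  exact (smul_right_injective _ (pow_ne_zero 2 ht) h1).symm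

theorem eval_smul_of_isHomogeneous {p : MvPolynomial (Fin 2) ℂ} {n : ℕ} (hp : p.IsHomogeneous n)
    (c : ℂ) (t : Fin 2 → ℂ) :
    MvPolynomial.eval (c • t) p = c ^ n * MvPolynomial.eval t p := by
  have h := hp.aeval_mul_left c t
  rwa [MvPolynomial.aeval_eq_eval, MvPolynomial.aeval_eq_eval] at h

variable {F : PolyPair} {R : MvPolynomial (Fin 2) ℂ} {e : ℕ}

theorem IsAdmissible.snd_homogeneous (hF : F.IsAdmissible R e) : F.2.IsHomogeneous (e + 1) := by
  rw [hF.snd_eq, add_comm e 1]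
  exact (MvPolynomial.isHomogeneous_X ℂ (1 : Fin 2)).mul hF.homogeneous

/-- In the coordinates `(P, t₁ R)` with `s = t₂/t₁`, the reduced recursion is again `F_{s,1}`, also
at `t₂ = 0`, and the weighted norm `max(|P|, |s t₁ R|)` is exactly `‖F_n‖`. -/
theorem IsAdmissible.near_infty (hF : F.IsAdmissible R e) {t₀ : Fin 2 → ℂ} (h0 : t₀ 0 ≠ 0)
    (h1 : t₀ 1 = 0) :
    (∃ C : ℝ, ∀ᶠ t in nhds t₀, QuarticGrowth C (fun n => ‖(F.iter n).eval t‖)) ∧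
      Filter.Tendsto (fun n => Real.log ‖(F.iter n).eval t₀‖ / 4 ^ n) Filter.atTop
        (nhds (Real.log ‖(F.eval t₀).1‖)) := by
  have e0 : ∀ᶠ t in nhds t₀, t 0 ≠ 0 := (continuous_apply 0).continuousAt.eventually_ne h0
  have hs : ContinuousAt (fun t : Fin 2 → ℂ => t 1 / t 0) t₀ :=
    (continuous_apply 1).continuousAt.div (continuous_apply 0).continuousAt h0
  refine quarticGrowth_and_tendsto_of_degenerate (s := fun t => t 1 / t 0)
    (p := fun n t => (MvPolynomial.eval t (reducedIter F.1 R n).1,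
      t 0 * MvPolynomial.eval t (reducedIter F.1 R n).2)) hs (by simp [h1]) ?_ ?_ ?_ ?_
  · filter_upwards [e0] with t ht n
    ext
    · simp only [reducedIter, lattesMap, map_pow, map_mul, map_sub, MvPolynomial.eval_X]
      field_simp
    · simp only [reducedIter, lattesMap, map_mul, map_sub, MvPolynomial.eval_X, map_ofNat]
      field_simp
  · exact ((MvPolynomial.continuous_eval _).prodMk
      ((continuous_apply 0).mul (MvPolynomial.continuous_eval _))).continuousAt
  · have ht : t₀ = t₀ 0 • ![1, 0] := by
      ext i
      fin_cases i <;> simp [h1]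
    change MvPolynomial.eval t₀ F.1 ≠ 0
    rw [ht, eval_smul_of_isHomogeneous hF.fst_homogeneous]
    exact mul_ne_zero (pow_ne_zero _ h0) hF.eval_infty
  · filter_upwards [e0, hs.norm.eventually_lt continuousAt_const (by simp [h1] :
      ‖t₀ 1 / t₀ 0‖ < 1)] with t ht hst n
    have hN : ‖(F.iter n).eval t‖ = max ‖MvPolynomial.eval t (reducedIter F.1 R n).1‖
        ‖t 1 / t 0 * (t 0 * MvPolynomial.eval t (reducedIter F.1 R n).2)‖ := by
      rw [iter_eq_reducedIter hF.snd_eq, ← mul_assoc, div_mul_cancel₀ _ ht, Prod.norm_def]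
      simp [eval]
    rw [← hN]
    refine ⟨by linarith [norm_nonneg ((F.iter n).eval t)], ?_⟩
    have hle : ‖(F.iter n).eval t‖ ≤ ‖(MvPolynomial.eval t (reducedIter F.1 R n).1,
        t 0 * MvPolynomial.eval t (reducedIter F.1 R n).2)‖ := by
      rw [hN, Prod.norm_def]
      refine max_le_max le_rfl ?_
      rw [norm_mul (t 1 / t 0)]
      exact mul_le_of_le_one_left (norm_nonneg _) hst.le
    exact hle.trans (le_mul_of_one_le_left (norm_nonneg _) one_le_two)

theorem IsAdmissible.near_zero (hF : F.IsAdmissible R e) {t₀ : Fin 2 → ℂ} (h0 : t₀ 0 = 0)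
    (h1 : t₀ 1 ≠ 0) :
    (∃ C : ℝ, ∀ᶠ t in nhds t₀, QuarticGrowth C (fun n => ‖(F.iter n).eval t‖)) ∧
      Filter.Tendsto (fun n => Real.log ‖(F.iter n).eval t₀‖ / 4 ^ n) Filter.atTop
        (nhds (Real.log ‖(F.eval t₀).1‖)) := by
  have e1 : ∀ᶠ t in nhds t₀, t 1 ≠ 0 := (continuous_apply 1).continuousAt.eventually_ne h1
  have hs : ContinuousAt (fun t : Fin 2 → ℂ => t 0 / t 1) t₀ :=
    (continuous_apply 0).continuousAt.div (continuous_apply 1).continuousAt h1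
  refine quarticGrowth_and_tendsto_of_degenerate (s := fun t => t 0 / t 1)
    (p := fun n t => (F.iter n).eval t) hs (by simp [h0]) ?_ F.continuous_eval.continuousAt ?_ ?_
  · filter_upwards [e1] with t ht n using eval_iter_succ hF.snd_eq n ht
  · have ht : t₀ = t₀ 1 • ![0, 1] := by
      ext i
      fin_cases i <;> simp [h0]
    change MvPolynomial.eval t₀ F.1 ≠ 0
    rw [ht, eval_smul_of_isHomogeneous hF.fst_homogeneous]
    exact mul_ne_zero (pow_ne_zero _ h1) hF.eval_zero
  · filter_upwards [hs.norm.eventually_lt continuousAt_const (by simp [h0] :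
      ‖t₀ 0 / t₀ 1‖ < 1)] with t hst n
    refine ⟨?_, le_mul_of_one_le_left (norm_nonneg _) one_le_two⟩
    refine le_trans ?_ (le_mul_of_one_le_left (norm_nonneg _) one_le_two)
    rw [Prod.norm_def]
    refine max_le_max le_rfl ?_
    rw [norm_mul]
    exact mul_le_of_le_one_left (norm_nonneg _) hst.le

theorem IsAdmissible.near_one (hF : F.IsAdmissible R e) {t₀ : Fin 2 → ℂ} (h0 : t₀ 0 = t₀ 1)
    (h1 : t₀ 1 ≠ 0) :
    (∃ C : ℝ, ∀ᶠ t in nhds t₀, QuarticGrowth C (fun n => ‖(F.iter n).eval t‖)) ∧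
      Filter.Tendsto (fun n => Real.log ‖(F.iter n).eval t₀‖ / 4 ^ n) Filter.atTop
        (nhds (Real.log ‖(F.eval t₀).1 - (F.eval t₀).2‖)) := by
  have e1 : ∀ᶠ t in nhds t₀, t 1 ≠ 0 := (continuous_apply 1).continuousAt.eventually_ne h1
  have hs : ContinuousAt (fun t : Fin 2 → ℂ => 1 - t 0 / t 1) t₀ :=
    continuousAt_const.sub
      ((continuous_apply 0).continuousAt.div (continuous_apply 1).continuousAt h1)
  have hs0 : 1 - t₀ 0 / t₀ 1 = 0 := by rw [h0, div_self h1, sub_self]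
  refine quarticGrowth_and_tendsto_of_degenerate (s := fun t => 1 - t 0 / t 1)
    (p := fun n t => (((F.iter n).eval t).1 - ((F.iter n).eval t).2, -((F.iter n).eval t).2))
    hs hs0 ?_ ?_ ?_ ?_
  · filter_upwards [e1] with t ht n
    rw [lattesMap_sub, eval_iter_succ hF.snd_eq n ht]
  · have h := F.continuous_eval
    exact ((h.fst.sub h.snd).prodMk h.snd.neg).continuousAt
  · have ht : t₀ = t₀ 1 • ![1, 1] := by
      ext i
      fin_cases i <;> simp [h0]
    change MvPolynomial.eval t₀ F.1 - MvPolynomial.eval t₀ F.2 ≠ 0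
    rw [ht, eval_smul_of_isHomogeneous hF.fst_homogeneous,
      eval_smul_of_isHomogeneous hF.snd_homogeneous, ← mul_sub]
    exact mul_ne_zero (pow_ne_zero _ h1) (sub_ne_zero.mpr hF.eval_one)
  · filter_upwards [hs.norm.eventually_lt continuousAt_const (by simp [hs0] :
      ‖1 - t₀ 0 / t₀ 1‖ < 1)] with t hst n
    have hz := norm_fst_le ((F.iter n).eval t)
    have hw := norm_snd_le ((F.iter n).eval t)
    have hsub := norm_sub_le ((F.iter n).eval t).1 ((F.iter n).eval t).2
    have hz' := norm_sub_norm_le ((F.iter n).eval t).1 ((F.iter n).eval t).2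
    constructor
    · refine max_le (by linarith) ?_
      rw [norm_mul, norm_neg]
      refine (mul_le_of_le_one_left (norm_nonneg _) hst.le).trans ?_
      linarith [norm_nonneg ((F.iter n).eval t)]
    · have ha := norm_fst_le (((F.iter n).eval t).1 - ((F.iter n).eval t).2,
        -((F.iter n).eval t).2)
      have hb := norm_snd_le (((F.iter n).eval t).1 - ((F.iter n).eval t).2,
        -((F.iter n).eval t).2)
      rw [norm_neg] at hb
      simp only at ha
      rw [Prod.norm_def ((F.iter n).eval t)]
      have hb0 := norm_nonneg ((F.iter n).eval t).2
      exact max_le (by linarith) (by linarith)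

theorem IsAdmissible.exists_quarticGrowth (hF : F.IsAdmissible R e) {t₀ : Fin 2 → ℂ}
    (ht₀ : t₀ ≠ 0) :
    ∃ C : ℝ, ∀ᶠ t in nhds t₀, QuarticGrowth C (fun n => ‖(F.iter n).eval t‖) := by
  by_cases h1 : t₀ 1 = 0
  · refine (hF.near_infty (fun h0 => ht₀ ?_) h1).1
    ext i
    fin_cases i <;> simp [h0, h1]
  by_cases h0 : t₀ 0 = 0
  · exact (hF.near_zero h0 h1).1
  by_cases h01 : t₀ 0 = t₀ 1
  · exact (hF.near_one h01 h1).1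
  refine eventually_quarticGrowth_lattesMap (s := fun t => t 0 / t 1)
    (p := fun n t => (F.iter n).eval t)
    ((continuous_apply 0).continuousAt.div (continuous_apply 1).continuousAt h1)
    (div_ne_zero h0 h1) (fun h => h01 ((div_eq_one_iff_eq h1).mp h)) ?_
    F.continuous_eval.continuousAt fun h => ?_
  · filter_upwards [(continuous_apply 1).continuousAt.eventually_ne h1] with t ht n using
      eval_iter_succ hF.snd_eq n ht
  · rcases hF.fst_homogeneous.eval_ne_zero_of_isRelPrime hF.snd_homogeneous hF.isRelPrime ht₀ with
      h' | h'
    exacts [h' (congrArg Prod.fst h), h' (congrArg Prod.snd h)]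

theorem IsAdmissible.eval_iter_ne_zero (hF : F.IsAdmissible R e) (n : ℕ) {t : Fin 2 → ℂ}
    (ht : t ≠ 0) : (F.iter n).eval t ≠ 0 := by
  obtain ⟨C, hC⟩ := hF.exists_quarticGrowth ht
  exact norm_pos_iff.mp (hC.self_of_nhds n).1

theorem IsAdmissible.deg_eq (hF : F.IsAdmissible R e) : F.deg = e + 1 :=
  IsHomogeneous.deg_eq ⟨hF.fst_homogeneous, hF.snd_homogeneous⟩ fun h => hF.eval_zero (by
    simp [eval, h])

theorem IsAdmissible.iter_isHomogeneous (hF : F.IsAdmissible R e) (n : ℕ) :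
    (F.iter n).IsHomogeneous (4 ^ n * F.deg) := by
  obtain ⟨k, hk, h1, h2⟩ := reducedIter_isHomogeneous hF.fst_homogeneous hF.homogeneous n
  rw [hF.deg_eq, ← hk, iter_eq_reducedIter hF.snd_eq]
  refine ⟨h1, ?_⟩
  rw [add_comm k 1]
  exact (MvPolynomial.isHomogeneous_X ℂ (1 : Fin 2)).mul h2

theorem IsAdmissible.iter_deg (hF : F.IsAdmissible R e) (n : ℕ) :
    (F.iter n).deg = 4 ^ n * F.deg := by
  refine (hF.iter_isHomogeneous n).deg_eq fun h => ?_
  -- The second entry is a multiple of `t₂` and vanishes at `(1, 0)`, so a zero first entry would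
  -- give a common zero there.
  refine hF.eval_iter_ne_zero n (t := ![1, 0]) (by simp) ?_
  rw [iter_eq_reducedIter hF.snd_eq] at h ⊢
  simp only at h
  simp [eval, h]

end PolyPair

/-! ### The main theorem. -/

theorem mainTheorem5 (c : RatFunc ℂ) (hc0 : c ≠ 0) (hc1 : c ≠ 1) (hct : c ≠ RatFunc.X)
    (C : PolyPair) (hC : C.IsHomogeneousLift c)
    (F₁ : PolyPair) (hF₁ : F₁.IsReductionOf C.lattes) :
    -- the maps are well defined, homogeneous of positive degree `4 ^ n * d`, without zeros off `0`
    0 < F₁.deg ∧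
    (∀ n : ℕ,
      (F₁.iter n).lattes.1 = MvPolynomial.X 1 ^ 2 * (F₁.iter (n + 1)).1 ∧
      (F₁.iter n).lattes.2 = MvPolynomial.X 1 ^ 2 * (F₁.iter (n + 1)).2) ∧
    (∀ n : ℕ, (F₁.iter n).IsHomogeneous (4 ^ n * F₁.deg) ∧ (F₁.iter n).deg = 4 ^ n * F₁.deg) ∧
    (∀ (n : ℕ) (t : Fin 2 → ℂ), t ≠ 0 → (F₁.iter n).eval t ≠ 0) ∧
    -- convergence
    ∃ G : (Fin 2 → ℂ) → ℝ,
      TendstoLocallyUniformlyOn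
        (fun (n : ℕ) (t : Fin 2 → ℂ) =>
          1 / ((F₁.iter n).deg : ℝ) * Real.log ‖(F₁.iter n).eval t‖)
        G Filter.atTop {0}ᶜ ∧
      ContinuousOn G {0}ᶜ ∧
      IsPlurisubharmonicOn G {0}ᶜ ∧
      -- values at the degenerate parameters
      ((F₁.eval ![1, 0]).1 ≠ 0 ∧
        G ![1, 0] = 1 / (F₁.deg : ℝ) * Real.log ‖(F₁.eval ![1, 0]).1‖) ∧
      ((F₁.eval ![0, 1]).1 ≠ 0 ∧
        G ![0, 1] = 1 / (F₁.deg : ℝ) * Real.log ‖(F₁.eval ![0, 1]).1‖) ∧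
      ((F₁.eval ![1, 1]).1 ≠ (F₁.eval ![1, 1]).2 ∧
        G ![1, 1] = 1 / (F₁.deg : ℝ) *
          Real.log ‖(F₁.eval ![1, 1]).1 - (F₁.eval ![1, 1]).2‖) := by
  obtain ⟨R, e, hF⟩ := hF₁.exists_isAdmissible hc0 hc1 hct hC
  have hne : ∀ (n : ℕ) (t : Fin 2 → ℂ), t ∈ ({0}ᶜ : Set (Fin 2 → ℂ)) → (F₁.iter n).eval t ≠ 0 :=
    fun n t ht => hF.eval_iter_ne_zero n ht
  refine ⟨by rw [hF.deg_eq]; exact e.succ_pos, fun n => ?_,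
    fun n => ⟨hF.iter_isHomogeneous n, hF.iter_deg n⟩, hne, ?_⟩
  · rw [PolyPair.lattes_iter hF.snd_eq]
    exact ⟨rfl, rfl⟩
  obtain ⟨G, hG⟩ := exists_tendstoLocallyUniformlyOn_of_quarticGrowth
    (Ω := ({0}ᶜ : Set (Fin 2 → ℂ))) (f := fun n t => ‖(F₁.iter n).eval t‖)
    fun t ht => hF.exists_quarticGrowth ht
  have hterm : ∀ (n : ℕ) (t : Fin 2 → ℂ),
      1 / ((F₁.iter n).deg : ℝ) * Real.log ‖(F₁.iter n).eval t‖ =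
        1 / (F₁.deg : ℝ) * (Real.log ‖(F₁.iter n).eval t‖ / 4 ^ n) := fun n t => by
    rw [hF.iter_deg]
    push_cast
    rw [one_div, one_div, mul_inv]
    ring
  have hlim : TendstoLocallyUniformlyOn
      (fun (n : ℕ) (t : Fin 2 → ℂ) =>
        1 / ((F₁.iter n).deg : ℝ) * Real.log ‖(F₁.iter n).eval t‖)
      (fun t => 1 / (F₁.deg : ℝ) * G t) Filter.atTop {0}ᶜ := by
    simp only [hterm]
    exact (Real.uniformContinuous_const_mul (x := 1 / (F₁.deg : ℝ))).comp_tendstoLocallyUniformlyOn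
      hG
  have hlogcont := fun n => PolyPair.continuousOn_log_norm_eval (hne n)
  have hcont := hlim.continuousOn
    (Filter.Eventually.frequently (Filter.Eventually.of_forall fun n => (hlogcont n).const_mul _))
  have hval : ∀ {t : Fin 2 → ℂ} {l : ℝ}, t ≠ 0 → Filter.Tendsto
      (fun n => Real.log ‖(F₁.iter n).eval t‖ / 4 ^ n) Filter.atTop (nhds l) →
      1 / (F₁.deg : ℝ) * G t = 1 / (F₁.deg : ℝ) * l := fun ht hl => by
    rw [tendsto_nhds_unique (hG.tendsto_at ht) hl]
  exact ⟨_, hlim, hcont,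
    IsPlurisubharmonicOn.of_tendstoLocallyUniformlyOn
      (fun n => (PolyPair.isPlurisubharmonicOn_log_norm_eval (hne n)).const_mul (hlogcont n)
        (by positivity)) hcont hlim,
    ⟨hF.eval_infty, hval (by simp) (hF.near_infty (by simp) (by simp)).2⟩,
    ⟨hF.eval_zero, hval (by simp) (hF.near_zero (by simp) (by simp)).2⟩,
    ⟨hF.eval_one, hval (by simp) (hF.near_one (by simp) (by simp)).2⟩⟩
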